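/- A \emph{frame} is a complete lattice in which binary meets distribute over arbitrary joins; a locale $X$ is given by its frame of opens $\Omega X$, and a locale map $f\colon X\to Y$ by a map $f^{-1}\colon\Omega Y\to\Omega X$ preserving finite meets and all joins. The product $X\times X$ has as frame of opens the frame coproduct $\Omega X\otimes\Omega X$, which is generated by the rectangles $U\otimes V$. A \emph{sublocale} of a locale $Y$ is a subset of $\Omega Y$ closed under all meets and under $x\to(-)$ for every $x\in\Omega Y$; sublocales are ordered by inclusion. A \emph{localic relation} on $X$ is a sublocale $R\rightarrowtail X\times X$; its source and target $s,t\colon R\to X$ are the composites of the inclusion with the two projections. The \emph{diagonal} $\Delta$ is the image of $(\mathrm{id},\mathrm{id})\colon X\to X\times X$, the \emph{opposite} $R^{\mathrm{op}}$ is the image of $(t,s)\colon R\to X\times X$, and $R\circ R$ is the image of $(s\pi_1,t\pi_2)\colon P\to X\times X$, where $P=R\times_X R$ is the pullback with $t\pi_1=s\pi_2$. The relation $R$ is \emph{reflexive} if $\Delta\subseteq R$, \emph{transitive} if $R\circ R\subseteq R$, and \emph{symmetric} if $R=R^{\mathrm{op}}$. A \emph{conic frame} $(\Omega X,\uparrow,\downarrow)$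 is a frame with two maps $\uparrow,\downarrow\colon\Omega X\to\Omega X$ that preserve all joins and are parallel: for all $U,V\in\Omega X$, \[ \uparrow U\wedge V\le\ \uparrow(U\wedge\downarrow V)\quad\text{and}\quad U\wedge\downarrow V\le\ \downarrow(\uparrow U\wedge V). \] On rectangles of $\Omega X\otimes\Omega X$ put $A\otimes B\sim C\otimes D$ iff $\uparrow A\wedge B=\uparrow C\wedge D$ and $A\wedge\downarrow B=C\wedge\downarrow D$. The induced localic relation $R_{\uparrow\downarrow}$ on $X$ is the sublocale of $X\times X$ consisting of the $\sim$-saturated elements, that is, of those $O\in\Omega X\otimes\Omega X$ such that, whenever $W\sim W'$, for all $Z$ one has $W\wedge Z\le O$ iff $W'\wedge Z\le O$. \textbf{Proposition.} For every conic frame $(\Omega X,\uparrow,\downarrow)$, the relation $R_{\uparrow\downarrow}$ is \begin{itemize} \item reflexive iff $\uparrow$ and $\downarrow$ are inflationary, i.e. $U\le\ \uparrow U$ and $U\le\ \downarrow U$ for all $U\in\Omega X$; \item transitive iff $\uparrow$ and $\downarrow$ are subidempotent, i.e. $\uparrow\uparrow U\le\ \uparrow U$ and $\downarrow\downarrow U\le\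 \downarrow U$ for all $U\in\Omega X$; \item symmetric iff $\uparrow=\downarrow$. \end{itemize} -/

import Mathlib

/-! Locales are handled through their frames of opens: a locale `X` is a frame `L`, and a locale map
`X → Y` is a `FrameHom` in the opposite direction.  Sublocales are Mathlib's `Sublocale`, ordered by
inclusion of sublocale sets, and `S.restrict : FrameHom L S` is the frame map of the inclusion of the
sublocale `S`. -/

noncomputable section

namespace ConicFrames

universe u v w

section Coproduct

/-- The lower sets of `L × M` that are closed under joins in each coordinate separately, as a
sublocale of the frame of all lower sets. -/
def biideals (L : Type u) (M : Type v) [Order.Frame L] [Order.Frame M] :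
    Sublocale (LowerSet (L × M)) where
  carrier := {D | (∀ (A : Set L) (y : M), (∀ a ∈ A, (a, y) ∈ D) → (sSup A, y) ∈ D) ∧
    (∀ (x : L) (B : Set M), (∀ b ∈ B, (x, b) ∈ D) → (x, sSup B) ∈ D)}
  sInf_mem' := by
    intro s hs
    refine ⟨fun A y h => ?_, fun x B h => ?_⟩
    · rw [LowerSet.mem_sInf_iff]
      exact fun D hD => (hs hD).1 A y fun a ha => LowerSet.mem_sInf_iff.1 (h a ha) D hD
    · rw [LowerSet.mem_sInf_iff]
      exact fun D hD => (hs hD).2 x B fun b hb => LowerSet.mem_sInf_iff.1 (h b hb) D hD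
  himp_mem' := by
    intro E D hD
    have key : ∀ p : L × M, p ∈ E ⇨ D ↔ ∀ q ≤ p, q ∈ E → q ∈ D := by
      intro p
      rw [← LowerSet.Iic_le, le_himp_iff]
      exact ⟨fun h q hq hE => h ⟨hq, hE⟩, fun h q hq => h q hq.1 hq.2⟩
    refine ⟨fun A y h => ?_, fun x B h => ?_⟩
    · rw [key]
      rintro ⟨a, b⟩ hq hE
      have h1 : a = sSup ((fun z => a ⊓ z) '' A) := by
        rw [sSup_image, ← inf_sSup_eq, inf_eq_left.2 hq.1]
      rw [h1]
      refine hD.1 _ _ ?_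
      rintro _ ⟨z, hz, rfl⟩
      exact (key _).1 (h z hz) _ ⟨inf_le_right, hq.2⟩ (E.lower (show (a ⊓ z, b) ≤ (a, b) from ⟨inf_le_left, le_rfl⟩) hE)
    · rw [key]
      rintro ⟨a, b⟩ hq hE
      have h1 : b = sSup ((fun z => b ⊓ z) '' B) := by
        rw [sSup_image, ← inf_sSup_eq, inf_eq_left.2 hq.2]
      rw [h1]
      refine hD.2 _ _ ?_
      rintro _ ⟨z, hz, rfl⟩
      exact (key _).1 (h z hz) _ ⟨hq.1, inf_le_right⟩ (E.lower (show (a, b ⊓ z) ≤ (a, b) from ⟨le_rfl, inf_le_left⟩) hE)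

/-- The coproduct `L ⊗ M` of two frames, i.e. the frame of opens of the product locale. -/
abbrev Coprod (L : Type u) (M : Type v) [Order.Frame L] [Order.Frame M] : Type (max u v) :=
  ↥(biideals L M)

variable {L : Type u} {M : Type v} {N : Type w} [Order.Frame L] [Order.Frame M] [Order.Frame N]

/-- The rectangle `x ⊗ y`: the least element of `L ⊗ M` that contains the pair `(x, y)`. -/
def rect (x : L) (y : M) : Coprod L M := (biideals L M).restrict (LowerSet.Iic (x, y))

theorem rect_le_iff {x : L} {y : M} {D : Coprod L M} : rect x y ≤ D ↔ (x, y) ∈ D.1 := by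
  unfold rect
  rw [(biideals L M).giRestrict.gc.le_iff_le, LowerSet.Iic_le]

theorem coprod_le_iff {D E : Coprod L M} : D ≤ E ↔ ∀ x y, rect x y ≤ D → rect x y ≤ E := by
  refine ⟨fun h x y hD => hD.trans h, fun h => ?_⟩
  rintro ⟨x, y⟩ hD
  exact rect_le_iff.1 (h x y (rect_le_iff.2 hD))

theorem rect_inf_rect (x x' : L) (y y' : M) :
    rect x y ⊓ rect x' y' = rect (x ⊓ x') (y ⊓ y') := by
  unfold rect
  rw [← map_inf]
  congr 1
  ext p
  simp only [LowerSet.coe_inf, LowerSet.coe_Iic, Set.mem_inter_iff, Set.mem_Iic, Prod.le_def,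
    le_inf_iff]
  tauto

theorem rect_top_top : rect (⊤ : L) (⊤ : M) = ⊤ := by
  rw [eq_top_iff, coprod_le_iff]
  intro x y _
  exact rect_le_iff.2 ((rect (⊤ : L) (⊤ : M)).1.lower ⟨le_top, le_top⟩ (rect_le_iff.1 le_rfl))

theorem rect_sSup_left (A : Set L) (y : M) : rect (sSup A) y = ⨆ a ∈ A, rect a y := by
  apply le_antisymm
  · exact rect_le_iff.2 ((⨆ a ∈ A, rect a y : Coprod L M).2.1 A y fun a ha =>
      rect_le_iff.1 (le_iSup₂ (f := fun a (_ : a ∈ A) => rect a y) a ha))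
  · exact iSup₂_le fun a ha => rect_le_iff.2
      ((rect (sSup A) y).1.lower (show (a, y) ≤ (sSup A, y) from ⟨le_sSup ha, le_rfl⟩)
        (rect_le_iff.1 le_rfl))

theorem rect_sSup_right (x : L) (B : Set M) : rect x (sSup B) = ⨆ b ∈ B, rect x b := by
  apply le_antisymm
  · exact rect_le_iff.2 ((⨆ b ∈ B, rect x b : Coprod L M).2.2 x B fun b hb =>
      rect_le_iff.1 (le_iSup₂ (f := fun b (_ : b ∈ B) => rect x b) b hb))
  · exact iSup₂_le fun b hb => rect_le_iff.2
      ((rect x (sSup B)).1.lower (show (x, b) ≤ (x, sSup B) from ⟨le_rfl, le_sSup hb⟩)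
        (rect_le_iff.1 le_rfl))

/-- The first coproduct injection `x ↦ x ⊗ ⊤`, i.e. the first product projection of locales. -/
def inl : FrameHom L (Coprod L M) where
  toFun x := rect x ⊤
  map_inf' x y := by simp [rect_inf_rect]
  map_top' := rect_top_top
  map_sSup' s := by rw [rect_sSup_left, sSup_image]

/-- The second coproduct injection `y ↦ ⊤ ⊗ y`, i.e. the second product projection of locales. -/
def inr : FrameHom M (Coprod L M) where
  toFun y := rect ⊤ y
  map_inf' x y := by simp [rect_inf_rect]
  map_top' := rect_top_top
  map_sSup' s := by rw [rect_sSup_right, sSup_image]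

/-- The right adjoint of the copairing. -/
def copairAdj (h : FrameHom L N) (k : FrameHom M N) (n : N) : Coprod L M where
  val := ⟨{p | h p.1 ⊓ k p.2 ≤ n}, fun _ _ hpq hp =>
    (inf_le_inf (OrderHomClass.mono h hpq.1) (OrderHomClass.mono k hpq.2)).trans hp⟩
  property := by
    refine ⟨fun A y hA => ?_, fun x B hB => ?_⟩
    · change h (sSup A) ⊓ k y ≤ n
      rw [map_sSup, sSup_inf_eq, iSup₂_le_iff]
      rintro _ ⟨a, ha, rfl⟩
      exact hA a ha
    · change h x ⊓ k (sSup B) ≤ n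
      rw [map_sSup, inf_sSup_eq, iSup₂_le_iff]
      rintro _ ⟨b, hb, rfl⟩
      exact hB b hb

theorem copair_gc (h : FrameHom L N) (k : FrameHom M N) :
    GaloisConnection (fun D : Coprod L M => ⨆ p ∈ D.1, h p.1 ⊓ k p.2) (copairAdj h k) :=
  fun _ _ => iSup₂_le_iff

/-- The copairing `[h, k] : L ⊗ M → N`, i.e. the pairing of locale maps into a product. -/
def copair (h : FrameHom L N) (k : FrameHom M N) : FrameHom (Coprod L M) N where
  toFun D := ⨆ p ∈ D.1, h p.1 ⊓ k p.2
  map_inf' D E := by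
    apply le_antisymm
    · exact (copair_gc h k).monotone_l.map_inf_le D E
    · rw [iSup₂_inf_eq]
      refine iSup₂_le fun p hp => ?_
      rw [inf_iSup₂_eq]
      refine iSup₂_le fun q hq => ?_
      refine le_trans (le_of_eq ?_) (le_iSup₂_of_le (p ⊓ q)
        ⟨D.1.lower inf_le_left hp, E.1.lower inf_le_right hq⟩ le_rfl)
      simp only [Prod.fst_inf, Prod.snd_inf, map_inf]
      exact inf_inf_inf_comm _ _ _ _
  map_top' := by
    rw [eq_top_iff]
    exact le_iSup₂_of_le (⊤ : L × M) trivial (by simp)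
  map_sSup' s := by rw [(copair_gc h k).l_sSup, sSup_image]

theorem copair_rect (h : FrameHom L N) (k : FrameHom M N) (x : L) (y : M) :
    copair h k (rect x y) = h x ⊓ k y := by
  apply le_antisymm
  · exact (copair_gc h k _ _).2 (rect_le_iff.2 (le_refl (h x ⊓ k y)))
  · exact le_iSup₂_of_le (f := fun (p : L × M) (_ : p ∈ (rect x y).1) => h p.1 ⊓ k p.2)
      (x, y) (rect_le_iff.1 le_rfl) le_rfl

end Coproduct

section Quotient

variable {L : Type u} [Order.Frame L]

/-- The quotient `L/∼` of a frame by an arbitrary binary relation: the sublocale of saturated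
elements.  Its quotient map `μ_∼` is `(quot r).restrict`. -/
def quot (r : L → L → Prop) : Sublocale L where
  carrier := {s | ∀ a b c, r a b → (a ⊓ c ≤ s ↔ b ⊓ c ≤ s)}
  sInf_mem' := by
    intro S hS a b c hab
    simp only [le_sInf_iff]
    exact forall₂_congr fun s hs => hS hs a b c hab
  himp_mem' := by
    intro x s hs a b c hab
    rw [le_himp_iff, le_himp_iff, inf_assoc, inf_assoc]
    exact hs a b (c ⊓ x) hab

/-- The image of the locale map given by the frame map `h : L → N`, as a sublocale: the set of
values of the right adjoint of `h`. -/
def image {N : Type v} [Order.Frame N] (h : FrameHom L N) : Sublocale L where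
  carrier := {a | ∃ n : N, ∀ b, h b ≤ n ↔ b ≤ a}
  sInf_mem' := by
    intro S hS
    choose f hf using hS
    refine ⟨⨅ a : S, f a.2, fun b => ?_⟩
    rw [le_iInf_iff, le_sInf_iff, Subtype.forall]
    exact forall₂_congr fun a ha => hf ha b
  himp_mem' := by
    rintro x a ⟨n, hn⟩
    refine ⟨h x ⇨ n, fun b => ?_⟩
    rw [le_himp_iff, le_himp_iff, ← map_inf, hn]

end Quotient

section Relations

/-- A localic relation on the locale with frame of opens `L`: a sublocale of the product. -/
abbrev LocRel (L : Type u) [Order.Frame L] : Type u := Sublocale (Coprod L L)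

variable {L : Type u} [Order.Frame L]

namespace LocRel

/-- The frame map `s⁻¹` of the source map `s : R → X`. -/
def source (R : LocRel L) : FrameHom L R := R.restrict.comp inl

/-- The frame map `t⁻¹` of the target map `t : R → X`. -/
def target (R : LocRel L) : FrameHom L R := R.restrict.comp inr

/-- The diagonal relation: the image of `(id, id) : X → X × X`. -/
def diagonal (L : Type u) [Order.Frame L] : LocRel L :=
  image (copair (FrameHom.id L) (FrameHom.id L))

/-- The opposite relation: the image of `(t, s) : R → X × X`. -/
def op (R : LocRel L) : LocRel L := image (copair R.target R.source)

/-- The pullback `R ×_X Q` of the target map of `R` along the source map of `Q`, as the sublocale of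
`R × Q` on which `t_R ∘ π₁` and `s_Q ∘ π₂` agree. -/
def pullback (R Q : LocRel L) : Sublocale (Coprod R Q) :=
  quot fun a b => ∃ U : L, a = inl (R.target U) ∧ b = inr (Q.source U)

/-- The composite `R ∘ Q`: the image of `(s_R ∘ π₁, t_Q ∘ π₂) : R ×_X Q → X × X`. -/
def comp (R Q : LocRel L) : LocRel L :=
  image (copair (((pullback R Q).restrict.comp inl).comp R.source)
    (((pullback R Q).restrict.comp inr).comp Q.target))

/-- `R` is reflexive if it contains the diagonal. -/
def Reflexive (R : LocRel L) : Prop := diagonal L ≤ R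

/-- `R` is transitive if it contains `R ∘ R`. -/
def Transitive (R : LocRel L) : Prop := comp R R ≤ R

/-- `R` is symmetric if it equals its opposite. -/
def Symmetric (R : LocRel L) : Prop := R = op R

end LocRel

end Relations

section Cones

variable {L : Type u} [Order.Frame L]

/-- `(L, up, down)` is a conic frame: the cones preserve all joins and are parallel. -/
structure IsConicFrame (up down : L → L) : Prop where
  up_sSup : ∀ A : Set L, up (sSup A) = sSup (up '' A)
  down_sSup : ∀ A : Set L, down (sSup A) = sSup (down '' A)
  parallel_up : ∀ x y, up x ⊓ y ≤ up (x ⊓ down y)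
  parallel_down : ∀ x y, x ⊓ down y ≤ down (up x ⊓ y)

/-- The relation `∼` on the rectangles of `L ⊗ L`: `a ⊗ b ∼ c ⊗ d` iff the reduced cones of
`(a, b)` and `(c, d)` agree. -/
def ConeSim (up down : L → L) (W W' : Coprod L L) : Prop :=
  ∃ a b c d : L, W = rect a b ∧ W' = rect c d ∧
    up a ⊓ b = up c ⊓ d ∧ a ⊓ down b = c ⊓ down d

/-- The localic relation induced by a pair of cones: the quotient `(L ⊗ L)/∼`. -/
def inducedRel (up down : L → L) : LocRel L := quot (ConeSim up down)

/-- `x ≤ c x` for all `x`. -/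
def Inflationary (c : L → L) : Prop := ∀ x, x ≤ c x

/-- `c (c x) ≤ c x` for all `x`. -/
def Subidempotent (c : L → L) : Prop := ∀ x, c (c x) ≤ c x

end Cones

end ConicFrames

end

/-! A pair of locale maps `f, g : Y → X` factors through `R_{↑↓}` exactly when
`f⁻¹ a ≤ g⁻¹ (↑ a)` and `g⁻¹ b ≤ f⁻¹ (↓ b)` for all opens `a`, `b`.  Each of the three properties
says that one particular pair of maps factors through `R_{↑↓}`, so each becomes a family of such
inequalities.  To read them off in `X`, one uses that the source and target maps `s`, `t` of
`R_{↑↓}` are open, with direct images `t_! s⁻¹ = ↑` and `s_! t⁻¹ = ↓`.  For transitivity, openness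
moreover makes the two legs of `R ×_X R` satisfy an interpolation property (Beck–Chevalley):
an inequality between opens pulled back along the two legs factors through an open of `X`. -/

noncomputable section

namespace ConicFrames

universe u v w

section Coproduct

variable {L : Type u} {M : Type v} {N : Type w} [Order.Frame L] [Order.Frame M] [Order.Frame N]

theorem iSup_rect (D : Coprod L M) : ⨆ p ∈ D.1, rect p.1 p.2 = D :=
  le_antisymm (iSup₂_le fun _ hp => rect_le_iff.2 hp) <|
    coprod_le_iff.2 fun x y h =>
      le_iSup₂_of_le (f := fun (p : L × M) (_ : p ∈ D.1) => rect p.1 p.2) (x, y)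
        (rect_le_iff.1 h) le_rfl

theorem inf_le_iff_forall_rect {W Z D : Coprod L M} :
    W ⊓ Z ≤ D ↔ ∀ x y, rect x y ≤ Z → W ⊓ rect x y ≤ D := by
  simp only [inf_comm W, ← le_himp_iff]
  exact coprod_le_iff.trans (by simp only [le_himp_iff])

theorem inl_inf_rect (x x' : L) (y : M) : inl x ⊓ rect x' y = rect (x ⊓ x') y :=
  (rect_inf_rect x x' ⊤ y).trans (by rw [top_inf_eq])

theorem inr_inf_rect (x : L) (y y' : M) : inr y ⊓ rect x y' = rect x (y ⊓ y') :=
  (rect_inf_rect ⊤ x y y').trans (by rw [top_inf_eq])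

theorem inl_inf_inr (x : L) (y : M) : inl x ⊓ inr y = rect x y :=
  (inl_inf_rect x ⊤ y).trans (by rw [inf_top_eq])

theorem frameHom_ext_rect {f g : FrameHom (Coprod L M) N}
    (h : ∀ x y, f (rect x y) = g (rect x y)) : f = g := by
  ext D
  rw [← iSup_rect D]
  simp only [map_iSup₂, h]

/-- The coproduct symmetry `x ⊗ y ↦ y ⊗ x`, i.e. the twist map of the product of locales. -/
def swap : FrameHom (Coprod L M) (Coprod M L) := copair inr inl

theorem swap_rect (x : L) (y : M) : swap (rect x y) = rect y x := by
  rw [swap, copair_rect, inf_comm, inl_inf_inr]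

theorem swap_swap (D : Coprod L M) : swap (swap D) = D := by
  have swap_comp_swap : swap.comp swap = FrameHom.id (Coprod L M) :=
    frameHom_ext_rect fun x y => (congrArg swap (swap_rect x y)).trans (swap_rect y x)
  exact DFunLike.congr_fun swap_comp_swap D

theorem copair_comp_swap (f : FrameHom L N) (g : FrameHom M N) :
    (copair f g).comp swap = copair g f :=
  frameHom_ext_rect fun x y => by
    rw [FrameHom.comp_apply, swap_rect, copair_rect, copair_rect, inf_comm]

theorem swap_le_iff {D : Coprod L M} {E : Coprod M L} : swap D ≤ E ↔ D ≤ swap E :=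
  ⟨fun h => (swap_swap D).ge.trans (OrderHomClass.mono swap h),
    fun h => (OrderHomClass.mono swap h).trans (swap_swap E).le⟩

/-- The open of the product consisting of the rectangles `x ⊗ y` with `f x ⊓ g y ≤ n`.  As a
function of `n` it is the right adjoint of the map of complete lattices `L ⊗ M → N` that extends
`x ⊗ y ↦ f x ⊓ g y`; unlike in `copairAdj`, the maps `f` and `g` need not preserve meets. -/
def infAdj (f : sSupHom L N) (g : sSupHom M N) (n : N) : Coprod L M where
  val := ⟨{p | f p.1 ⊓ g p.2 ≤ n}, fun _ _ hpq hp =>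
    (inf_le_inf (OrderHomClass.mono f hpq.1) (OrderHomClass.mono g hpq.2)).trans hp⟩
  property := by
    refine ⟨fun A y hA => ?_, fun x B hB => ?_⟩
    · change f (sSup A) ⊓ g y ≤ n
      rw [map_sSup, sSup_inf_eq, iSup₂_le_iff]
      exact Set.forall_mem_image.2 hA
    · change f x ⊓ g (sSup B) ≤ n
      rw [map_sSup, inf_sSup_eq, iSup₂_le_iff]
      exact Set.forall_mem_image.2 hB

theorem rect_le_infAdj_iff {f : sSupHom L N} {g : sSupHom M N} {n : N} {x : L} {y : M} :
    rect x y ≤ infAdj f g n ↔ f x ⊓ g y ≤ n :=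
  rect_le_iff

end Coproduct

section Sublocales

variable {L : Type u} {M : Type v} {N : Type w} [Order.Frame L] [Order.Frame M] [Order.Frame N]

theorem restrict_le_iff {S : Sublocale L} {x : L} {y : S} : S.restrict x ≤ y ↔ x ≤ y.1 :=
  S.giRestrict.gc.le_iff_le

theorem mem_image_iff {f : FrameHom L N} {a : L} :
    a ∈ image f ↔ ∃ n, ∀ b, f b ≤ n ↔ b ≤ a :=
  Iff.rfl

theorem image_restrict (S : Sublocale L) : image S.restrict = S := by
  ext a
  refine ⟨?_, fun ha => ⟨⟨a, ha⟩, fun _ => restrict_le_iff⟩⟩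
  rintro ⟨n, hn⟩
  have n_eq_a : n.1 = a := eq_of_forall_le_iff fun b => restrict_le_iff.symm.trans (hn b)
  exact n_eq_a ▸ n.2

theorem restrict_quot_eq {r : L → L → Prop} {a b : L} (hab : r a b) :
    (quot r).restrict a = (quot r).restrict b :=
  eq_of_forall_ge_iff fun z => by
    simpa only [restrict_le_iff, inf_top_eq] using z.2 a b ⊤ hab

theorem map_le_iff_le_sSup {f : FrameHom L N} {a : L} {n : N} :
    f a ≤ n ↔ a ≤ sSup {b | f b ≤ n} := by
  refine ⟨fun h => le_sSup h, fun h => (OrderHomClass.mono f h).trans ?_⟩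
  rw [map_sSup]
  exact sSup_le (Set.forall_mem_image.2 fun _ hb => hb)

theorem image_le_quot_iff {r : L → L → Prop} {f : FrameHom L N} :
    image f ≤ quot r ↔ ∀ a b, r a b → f a = f b := by
  constructor
  · intro hle a b hab
    refine eq_of_forall_ge_iff fun n => ?_
    have adj_mem : sSup {c | f c ≤ n} ∈ quot r := hle ⟨n, fun _ => map_le_iff_le_sSup⟩
    simpa only [inf_top_eq, ← map_le_iff_le_sSup] using adj_mem a b ⊤ hab
  · rintro hr O ⟨n, hn⟩ a b c hab
    rw [← hn, ← hn, map_inf, map_inf, hr a b hab]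

theorem mem_quot_iff_forall_rect {r : Coprod L M → Coprod L M → Prop} {D : Coprod L M} :
    D ∈ quot r ↔
      ∀ W W', r W W' → ∀ x y, W ⊓ rect x y ≤ D ↔ W' ⊓ rect x y ≤ D := by
  refine ⟨fun hD W W' hW x y => hD W W' _ hW, fun hD W W' Z hW => ?_⟩
  rw [inf_le_iff_forall_rect, inf_le_iff_forall_rect]
  exact forall₃_congr fun x y _ => hD W W' hW x y

end Sublocales

section OpenMaps

variable {L : Type u} {M : Type v} {N : Type w} [Order.Frame L] [Order.Frame M] [Order.Frame N]

/-- A locale map is open if its frame map preserves all meets and the Heyting implication; by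
Joyal and Tierney, this is equivalent to the images of open sublocales being open. -/
structure IsOpenHom (f : FrameHom L M) : Prop where
  map_sInf : ∀ A : Set L, f (sInf A) = sInf (f '' A)
  map_himp : ∀ U V, f (U ⇨ V) = f U ⇨ f V

/-- The fibre product of the locale maps given by the frame maps `f` and `g`, as the sublocale of
the product obtained by identifying `f U ⊗ ⊤` with `⊤ ⊗ g U`.  For relations `R`, `Q` the fibre
product of `R.target` and `Q.source` is `LocRel.pullback R Q` by definition. -/
def fiberProduct (f : FrameHom L M) (g : FrameHom L N) : Sublocale (Coprod M N) :=
  quot fun a b => ∃ U : L, a = inl (f U) ∧ b = inr (g U)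

variable {f : FrameHom L M} {g : FrameHom L N}

theorem restrict_inl_map_eq_restrict_inr_map (f : FrameHom L M) (g : FrameHom L N) (U : L) :
    (fiberProduct f g).restrict (inl (f U)) = (fiberProduct f g).restrict (inr (g U)) :=
  restrict_quot_eq ⟨U, rfl, rfl⟩

theorem mem_fiberProduct_iff {D : Coprod M N} :
    D ∈ fiberProduct f g ↔ ∀ U m n, rect (f U ⊓ m) n ≤ D ↔ rect m (g U ⊓ n) ≤ D := by
  refine mem_quot_iff_forall_rect.trans ⟨fun h U m n => ?_, ?_⟩
  · simpa only [inl_inf_rect, inr_inf_rect] using h _ _ ⟨U, rfl, rfl⟩ m n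
  · rintro h _ _ ⟨U, rfl, rfl⟩ m n
    simpa only [inl_inf_rect, inr_inf_rect] using h U m n

namespace IsOpenHom

theorem sInf_setOf_le_map_le_iff (hf : IsOpenHom f) {m : M} {x : L} :
    sInf {y | m ≤ f y} ≤ x ↔ m ≤ f x := by
  refine ⟨fun h => le_trans ?_ (OrderHomClass.mono f h), fun h => sInf_le h⟩
  rw [hf.map_sInf]
  exact le_sInf (Set.forall_mem_image.2 fun _ hy => hy)

/-- The direct image `f_!` of opens along an open map, i.e. the left adjoint of the frame map. -/
def directImage (hf : IsOpenHom f) : sSupHom M L where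
  toFun m := sInf {x | m ≤ f x}
  map_sSup' A := by
    rw [sSup_image]
    exact GaloisConnection.l_sSup (u := f) fun _ _ => hf.sInf_setOf_le_map_le_iff

theorem directImage_le_iff (hf : IsOpenHom f) {m : M} {x : L} :
    hf.directImage m ≤ x ↔ m ≤ f x :=
  hf.sInf_setOf_le_map_le_iff

theorem le_map_directImage (hf : IsOpenHom f) (m : M) : m ≤ f (hf.directImage m) :=
  hf.directImage_le_iff.1 le_rfl

theorem directImage_map_inf (hf : IsOpenHom f) (U : L) (m : M) :
    hf.directImage (f U ⊓ m) = U ⊓ hf.directImage m :=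
  eq_of_forall_ge_iff fun V => by
    rw [directImage_le_iff, inf_comm, ← le_himp_iff, ← hf.map_himp, ← directImage_le_iff hf,
      le_himp_iff, inf_comm]

theorem restrict_inl_le_restrict_inr_iff (hf : IsOpenHom f) {m : M} {n : N} :
    (fiberProduct f g).restrict (inl m) ≤ (fiberProduct f g).restrict (inr n) ↔
      ∃ U, m ≤ f U ∧ g U ≤ n := by
  constructor
  · intro hmn
    let D : Coprod M N := infAdj ((g : sSupHom L N).comp hf.directImage) (sSupHom.id N) n
    have rect_le_D {x y} : rect x y ≤ D ↔ g (hf.directImage x) ⊓ y ≤ n := rect_le_infAdj_iff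
    have D_mem : D ∈ fiberProduct f g := mem_fiberProduct_iff.2 fun U x y => by
      rw [rect_le_D, rect_le_D, directImage_map_inf, map_inf, inf_assoc, inf_left_comm]
    have inr_le_D : (fiberProduct f g).restrict (inr n) ≤ ⟨D, D_mem⟩ :=
      restrict_le_iff.2 (rect_le_D.2 inf_le_right)
    have inl_le_D : rect m ⊤ ≤ D := restrict_le_iff.1 (hmn.trans inr_le_D)
    exact ⟨hf.directImage m, hf.le_map_directImage m,
      by simpa only [inf_top_eq] using rect_le_D.1 inl_le_D⟩
  · rintro ⟨U, hm, hn⟩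
    calc (fiberProduct f g).restrict (inl m)
      _ ≤ (fiberProduct f g).restrict (inl (f U)) := by gcongr
      _ = (fiberProduct f g).restrict (inr (g U)) := restrict_inl_map_eq_restrict_inr_map f g U
      _ ≤ (fiberProduct f g).restrict (inr n) := by gcongr

theorem restrict_inr_le_restrict_inl_iff (hg : IsOpenHom g) {m : M} {n : N} :
    (fiberProduct f g).restrict (inr n) ≤ (fiberProduct f g).restrict (inl m) ↔
      ∃ U, n ≤ g U ∧ f U ≤ m := by
  constructor
  · intro hnm
    let D : Coprod M N := infAdj (sSupHom.id M) ((f : sSupHom L M).comp hg.directImage) m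
    have rect_le_D {x y} : rect x y ≤ D ↔ x ⊓ f (hg.directImage y) ≤ m := rect_le_infAdj_iff
    have D_mem : D ∈ fiberProduct f g := mem_fiberProduct_iff.2 fun U x y => by
      rw [rect_le_D, rect_le_D, directImage_map_inf, map_inf, inf_assoc, inf_left_comm]
    have inl_le_D : (fiberProduct f g).restrict (inl m) ≤ ⟨D, D_mem⟩ :=
      restrict_le_iff.2 (rect_le_D.2 inf_le_left)
    have inr_le_D : rect ⊤ n ≤ D := restrict_le_iff.1 (hnm.trans inl_le_D)
    exact ⟨hg.directImage n, hg.le_map_directImage n,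
      by simpa only [top_inf_eq] using rect_le_D.1 inr_le_D⟩
  · rintro ⟨U, hn, hm⟩
    calc (fiberProduct f g).restrict (inr n)
      _ ≤ (fiberProduct f g).restrict (inr (g U)) := by gcongr
      _ = (fiberProduct f g).restrict (inl (f U)) :=
        (restrict_inl_map_eq_restrict_inr_map f g U).symm
      _ ≤ (fiberProduct f g).restrict (inl m) := by gcongr

end IsOpenHom

end OpenMaps

section Relations

variable {L : Type u} [Order.Frame L]

namespace LocRel

theorem source_inf_target (R : LocRel L) (a b : L) :
    R.source a ⊓ R.target b = R.restrict (rect a b) := by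
  rw [← inl_inf_inr, map_inf]
  rfl

theorem copair_source_target (R : LocRel L) : copair R.source R.target = R.restrict :=
  frameHom_ext_rect fun a b => by rw [copair_rect, source_inf_target]

theorem image_copair_source_target (R : LocRel L) : image (copair R.source R.target) = R := by
  rw [copair_source_target, image_restrict]

theorem source_inf_target_le_iff {R : LocRel L} {a b : L} {r : R} :
    R.source a ⊓ R.target b ≤ r ↔ rect a b ≤ r.1 := by
  rw [source_inf_target, restrict_le_iff]

theorem eq_of_forall_source_inf_target_le_iff {R : LocRel L} {r r' : R}
    (h : ∀ a b, R.source a ⊓ R.target b ≤ r ↔ R.source a ⊓ R.target b ≤ r') : r = r' := by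
  simp only [source_inf_target_le_iff] at h
  exact le_antisymm (coprod_le_iff.2 fun a b => (h a b).1) (coprod_le_iff.2 fun a b => (h a b).2)

theorem mem_op_iff {R : LocRel L} {O : Coprod L L} : O ∈ R.op ↔ swap O ∈ R := by
  have adj (n : R) (D : Coprod L L) : copair R.target R.source D ≤ n ↔ D ≤ swap n.1 := by
    rw [← copair_comp_swap, copair_source_target, FrameHom.comp_apply, restrict_le_iff,
      swap_le_iff]
  simp only [op, mem_image_iff, adj]
  constructor
  · rintro ⟨n, hn⟩
    rw [← eq_of_forall_le_iff hn, swap_swap]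
    exact n.2
  · exact fun hO => ⟨⟨swap O, hO⟩, fun D => by rw [swap_swap]⟩

theorem symmetric_iff_op_le {R : LocRel L} : R.Symmetric ↔ R.op ≤ R := by
  refine ⟨Eq.ge, fun h => le_antisymm (fun O hO => ?_) h⟩
  exact mem_op_iff.2 (h (mem_op_iff.2 (by rwa [swap_swap])))

end LocRel

end Relations

section Cones

variable {L : Type u} {N : Type v} [Order.Frame L] [Order.Frame N] {up down : L → L}

theorem exists_ge_and_map_le_iff {α : Type u} {β : Type v} [Preorder α] [Preorder β] {f : α → β}
    (hf : Monotone f) {a : α} {b : β} : (∃ c, a ≤ c ∧ f c ≤ b) ↔ f a ≤ b :=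
  ⟨fun ⟨_, hac, hcb⟩ => (hf hac).trans hcb, fun hab => ⟨a, le_rfl, hab⟩⟩

namespace IsConicFrame

theorem symm (h : IsConicFrame up down) : IsConicFrame down up where
  up_sSup := h.down_sSup
  down_sSup := h.up_sSup
  parallel_up x y := by simpa only [inf_comm] using h.parallel_down y x
  parallel_down x y := by simpa only [inf_comm] using h.parallel_up y x

/-- The upward cone `↑` as a join-preserving map; the downward cone is `h.symm.upHom`. -/
def upHom (h : IsConicFrame up down) : sSupHom L L := ⟨up, h.up_sSup⟩

theorem up_mono (h : IsConicFrame up down) : Monotone up :=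
  OrderHomClass.mono h.upHom

theorem up_inf_down_inf (h : IsConicFrame up down) (a b : L) :
    up (a ⊓ down b) ⊓ b = up a ⊓ b :=
  le_antisymm (inf_le_inf_right b (h.up_mono inf_le_left))
    (le_inf (h.parallel_up a b) inf_le_right)

theorem inf_down_up_inf (h : IsConicFrame up down) (a b : L) :
    a ⊓ down (up a ⊓ b) = a ⊓ down b := by
  simpa only [inf_comm] using h.symm.up_inf_down_inf b a

theorem coneSim_rect (h : IsConicFrame up down) (a b : L) :
    ConeSim up down (rect a b) (rect (a ⊓ down b) (up a ⊓ b)) := by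
  refine ⟨a, b, _, _, rfl, rfl, ?_, ?_⟩
  · rw [inf_left_comm, h.up_inf_down_inf, ← inf_assoc, inf_idem]
  · rw [inf_right_comm, h.inf_down_up_inf, inf_assoc, inf_idem]

theorem image_copair_le_inducedRel_iff (h : IsConicFrame up down) {f g : FrameHom L N} :
    image (copair f g) ≤ inducedRel up down ↔
      (∀ a, f a ≤ g (up a)) ∧ ∀ b, g b ≤ f (down b) := by
  refine image_le_quot_iff.trans ⟨fun hsim => ?_, ?_⟩
  · have reduce a b : f a ⊓ g b = f (a ⊓ down b) ⊓ g (up a ⊓ b) := by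
      simpa only [copair_rect] using hsim _ _ (h.coneSim_rect a b)
    constructor
    · intro a
      calc f a = f (a ⊓ down ⊤) ⊓ g (up a ⊓ ⊤) := by rw [← reduce, map_top, inf_top_eq]
        _ ≤ g (up a) := by rw [inf_top_eq]; exact inf_le_right
    · intro b
      calc g b = f (⊤ ⊓ down b) ⊓ g (up ⊤ ⊓ b) := by rw [← reduce, map_top, top_inf_eq]
        _ ≤ f (down b) := by rw [top_inf_eq]; exact inf_le_left
  · rintro ⟨hup, hdown⟩ _ _ ⟨a, b, c, d, rfl, rfl, up_eq, down_eq⟩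
    have reduce a b : f a ⊓ g b = f (a ⊓ down b) ⊓ g (up a ⊓ b) := by
      rw [map_inf, map_inf, inf_inf_inf_comm, inf_eq_left.2 (hup a), inf_eq_right.2 (hdown b)]
    rw [copair_rect, copair_rect, reduce, reduce c, up_eq, down_eq]

theorem up_inf_inf_eq (h : IsConicFrame up down) {a b c d : L}
    (up_eq : up a ⊓ b = up c ⊓ d) (down_eq : a ⊓ down b = c ⊓ down d) (x : L) :
    up (a ⊓ x) ⊓ b = up (c ⊓ x) ⊓ d := by
  have up_inf_inf_le {a b c d} (up_eq : up a ⊓ b = up c ⊓ d) (down_eq : a ⊓ down b = c ⊓ down d) :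
      up (a ⊓ x) ⊓ b ≤ up (c ⊓ x) ⊓ d := by
    refine le_inf ?_ ?_
    · calc up (a ⊓ x) ⊓ b
        _ ≤ up (a ⊓ x ⊓ down b) := h.parallel_up _ _
        _ = up (c ⊓ down d ⊓ x) := by rw [inf_right_comm, down_eq]
        _ ≤ up (c ⊓ x) := h.up_mono (inf_le_inf_right x inf_le_left)
    · calc up (a ⊓ x) ⊓ b
        _ ≤ up a ⊓ b := inf_le_inf_right b (h.up_mono inf_le_left)
        _ ≤ d := up_eq.trans_le inf_le_right
  exact le_antisymm (up_inf_inf_le up_eq down_eq) (up_inf_inf_le up_eq.symm down_eq.symm)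

theorem inf_down_inf_eq (h : IsConicFrame up down) {a b c d : L}
    (up_eq : up a ⊓ b = up c ⊓ d) (down_eq : a ⊓ down b = c ⊓ down d) (y : L) :
    a ⊓ down (b ⊓ y) = c ⊓ down (d ⊓ y) := by
  rw [inf_comm (up a), inf_comm (up c)] at up_eq
  rw [inf_comm a, inf_comm c] at down_eq ⊢
  exact h.symm.up_inf_inf_eq down_eq up_eq y

theorem infAdj_upHom_mem (h : IsConicFrame up down) (x : L) :
    infAdj h.upHom (sSupHom.id L) x ∈ inducedRel up down := by
  refine mem_quot_iff_forall_rect.2 ?_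
  rintro _ _ ⟨a, b, c, d, rfl, rfl, up_eq, down_eq⟩ y z
  rw [rect_inf_rect, rect_inf_rect, rect_le_infAdj_iff, rect_le_infAdj_iff]
  change up (a ⊓ y) ⊓ (b ⊓ z) ≤ x ↔ up (c ⊓ y) ⊓ (d ⊓ z) ≤ x
  rw [← inf_assoc, h.up_inf_inf_eq up_eq down_eq, inf_assoc]

theorem infAdj_downHom_mem (h : IsConicFrame up down) (x : L) :
    infAdj (sSupHom.id L) h.symm.upHom x ∈ inducedRel up down := by
  refine mem_quot_iff_forall_rect.2 ?_
  rintro _ _ ⟨a, b, c, d, rfl, rfl, up_eq, down_eq⟩ y z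
  rw [rect_inf_rect, rect_inf_rect, rect_le_infAdj_iff, rect_le_infAdj_iff]
  change a ⊓ y ⊓ down (b ⊓ z) ≤ x ↔ c ⊓ y ⊓ down (d ⊓ z) ≤ x
  rw [inf_right_comm, h.inf_down_inf_eq up_eq down_eq, inf_right_comm]

theorem source_le_target_up (h : IsConicFrame up down) (a : L) :
    (inducedRel up down).source a ≤ (inducedRel up down).target (up a) :=
  (h.image_copair_le_inducedRel_iff.1 (LocRel.image_copair_source_target _).le).1 a

theorem target_le_source_down (h : IsConicFrame up down) (b : L) :
    (inducedRel up down).target b ≤ (inducedRel up down).source (down b) :=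
  (h.image_copair_le_inducedRel_iff.1 (LocRel.image_copair_source_target _).le).2 b

theorem source_inf_target_le_target_iff (h : IsConicFrame up down) {a b x : L} :
    (inducedRel up down).source a ⊓ (inducedRel up down).target b ≤
      (inducedRel up down).target x ↔ up a ⊓ b ≤ x := by
  constructor
  · intro hle
    let U : inducedRel up down := ⟨_, h.infAdj_upHom_mem x⟩
    have target_le_U : (inducedRel up down).target x ≤ U :=
      restrict_le_iff.2 (rect_le_infAdj_iff.2 inf_le_right)
    exact rect_le_infAdj_iff.1 (LocRel.source_inf_target_le_iff.1 (hle.trans target_le_U))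
  · intro hle
    calc (inducedRel up down).source a ⊓ (inducedRel up down).target b
      _ ≤ (inducedRel up down).target (up a) ⊓ (inducedRel up down).target b :=
        inf_le_inf_right _ (h.source_le_target_up a)
      _ = (inducedRel up down).target (up a ⊓ b) := (map_inf _ _ _).symm
      _ ≤ (inducedRel up down).target x := OrderHomClass.mono _ hle

theorem source_inf_target_le_source_iff (h : IsConicFrame up down) {a b x : L} :
    (inducedRel up down).source a ⊓ (inducedRel up down).target b ≤
      (inducedRel up down).source x ↔ a ⊓ down b ≤ x := by
  constructor
  · intro hle
    let U : inducedRel up down := ⟨_, h.infAdj_downHom_mem x⟩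
    have source_le_U : (inducedRel up down).source x ≤ U :=
      restrict_le_iff.2 (rect_le_infAdj_iff.2 inf_le_left)
    exact rect_le_infAdj_iff.1 (LocRel.source_inf_target_le_iff.1 (hle.trans source_le_U))
  · intro hle
    calc (inducedRel up down).source a ⊓ (inducedRel up down).target b
      _ ≤ (inducedRel up down).source a ⊓ (inducedRel up down).source (down b) :=
        inf_le_inf_left _ (h.target_le_source_down b)
      _ = (inducedRel up down).source (a ⊓ down b) := (map_inf _ _ _).symm
      _ ≤ (inducedRel up down).source x := OrderHomClass.mono _ hle

theorem source_le_target_iff (h : IsConicFrame up down) {a x : L} :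
    (inducedRel up down).source a ≤ (inducedRel up down).target x ↔ up a ≤ x := by
  simpa only [map_top, inf_top_eq] using h.source_inf_target_le_target_iff (b := ⊤)

theorem target_le_source_iff (h : IsConicFrame up down) {b x : L} :
    (inducedRel up down).target b ≤ (inducedRel up down).source x ↔ down b ≤ x := by
  simpa only [map_top, top_inf_eq] using h.source_inf_target_le_source_iff (a := ⊤)

theorem isOpenHom_target (h : IsConicFrame up down) :
    IsOpenHom (inducedRel up down).target where
  map_sInf A := LocRel.eq_of_forall_source_inf_target_le_iff fun a b => by
    simp only [h.source_inf_target_le_target_iff, le_sInf_iff, Set.forall_mem_image]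
  map_himp U V := LocRel.eq_of_forall_source_inf_target_le_iff fun a b => by
    rw [h.source_inf_target_le_target_iff, le_himp_iff, le_himp_iff, inf_assoc, inf_assoc,
      ← map_inf, h.source_inf_target_le_target_iff]

theorem isOpenHom_source (h : IsConicFrame up down) :
    IsOpenHom (inducedRel up down).source where
  map_sInf A := LocRel.eq_of_forall_source_inf_target_le_iff fun a b => by
    simp only [h.source_inf_target_le_source_iff, le_sInf_iff, Set.forall_mem_image]
  map_himp U V := LocRel.eq_of_forall_source_inf_target_le_iff fun a b => by
    rw [h.source_inf_target_le_source_iff, le_himp_iff, le_himp_iff, inf_right_comm,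
      inf_right_comm (_ : inducedRel up down), ← map_inf, h.source_inf_target_le_source_iff]

theorem reflexive_inducedRel_iff (h : IsConicFrame up down) :
    (inducedRel up down).Reflexive ↔ Inflationary up ∧ Inflationary down :=
  h.image_copair_le_inducedRel_iff

theorem transitive_inducedRel_iff (h : IsConicFrame up down) :
    (inducedRel up down).Transitive ↔ Subidempotent up ∧ Subidempotent down := by
  refine h.image_copair_le_inducedRel_iff.trans
    (and_congr (forall_congr' fun x => ?_) (forall_congr' fun x => ?_))
  · rw [← exists_ge_and_map_le_iff h.up_mono]
    simp only [← h.source_le_target_iff]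
    exact h.isOpenHom_target.restrict_inl_le_restrict_inr_iff
  · rw [← exists_ge_and_map_le_iff h.symm.up_mono]
    simp only [← h.target_le_source_iff]
    exact h.isOpenHom_source.restrict_inr_le_restrict_inl_iff

theorem symmetric_inducedRel_iff (h : IsConicFrame up down) :
    (inducedRel up down).Symmetric ↔ up = down := by
  rw [LocRel.symmetric_iff_op_le, LocRel.op, h.image_copair_le_inducedRel_iff]
  simp only [h.target_le_source_iff, h.source_le_target_iff]
  rw [and_comm]
  exact (le_antisymm_iff (a := up) (b := down)).symm

end IsConicFrame

end Cones

end ConicFrames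

end

theorem mainTheorem6 {L : Type*} [Order.Frame L] (up down : L → L)
    (h : ConicFrames.IsConicFrame up down) :
    (ConicFrames.LocRel.Reflexive (ConicFrames.inducedRel up down) ↔
      ConicFrames.Inflationary up ∧ ConicFrames.Inflationary down) ∧
    (ConicFrames.LocRel.Transitive (ConicFrames.inducedRel up down) ↔
      ConicFrames.Subidempotent up ∧ ConicFrames.Subidempotent down) ∧
    (ConicFrames.LocRel.Symmetric (ConicFrames.inducedRel up down) ↔ up = down) :=
  ⟨h.reflexive_inducedRel_iff, h.transitive_inducedRel_iff, h.symmetric_inducedRel_iff⟩
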